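/- Let $p\ge 1$ and $q\ge 0$ be integers and $n=p+q$. Let $P=\mathrm{conv}(\{v^i\}_{i\in V})+\mathrm{cone}(\{r^j\}_{j\in E})\subseteq\mathbb R^n$, where $V,E$ are finite index sets, $v^i\in\mathbb Q^n$ for $i\in V$ and $r^j\in\mathbb Z^n$ for $j\in E$ (for instance the vertices and the extreme rays of a pointed rational polyhedron $P$). A convex set $C\subseteq\mathbb R^p$ is called lattice point free if its relative interior contains no point of $\mathbb Z^p$. A split polyhedron in $\mathbb R^p$ is a rational polyhedron that is inclusion-maximal among the lattice point free convex sets in $\mathbb R^p$, and a mixed integer split polyhedron in $\mathbb R^n$ is a set $L=\{(x,y)\in\mathbb R^p\times\mathbb R^q : x\in L^x\}$, where $L^x$ is a split polyhedron in $\mathbb R^p$. Every facet of $L$ is written as $\pi^Tx\ge\pi_0$ with $(\pi,\pi_0)\in\mathbb Z^{n+1}$, where the integers $\pi_0,\pi_1,\dots,\pi_n$ have no common divisor greater than $1$. The max-facet-width $w_f(L)$ is the maximum, over all facets $\pi^Tx\ge\pi_0$ of $L$ written in this form, of $\max_{x\in L}\pi^Tx-\min_{x\in L}\pi^Tx$.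 For $L\subseteq\mathbb R^n$ let $R(L,P):=\mathrm{conv}(\{x\in P : x\notin\mathrm{ri}(L)\})$, where $\mathrm{ri}$ denotes the relative interior. Let $w>0$ be a real number, and let $\mathcal L^w$ be the set of all mixed integer split polyhedra $L\subseteq\mathbb R^n$ with $w_f(L)\le w$. Then, for every family $\bar{\mathcal L}\subseteq\mathcal L^w$, the set $\bigcap_{L\in\bar{\mathcal L}}R(L,P)$ is a polyhedron, that is, the solution set in $\mathbb R^n$ of a finite system of linear inequalities (the intersection of the empty family being $\mathbb R^n$). In particular, the $w$-th split closure $\bigcap_{L\in\mathcal L^w}R(L,P)$ of $P$ is a polyhedron. -/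

import Mathlib

open scoped Pointwise

noncomputable section

namespace SplitClosure

/-- A polyhedron in `ℝⁿ`: the solution set of a finite system of linear inequalities. -/
def IsPolyhedron {n : ℕ} (S : Set (Fin n → ℝ)) : Prop :=
  ∃ (m : ℕ) (A : Fin m → Fin n → ℝ) (b : Fin m → ℝ),
    S = {x | ∀ k, b k ≤ ∑ i, A k i * x i}

/-- A rational polyhedron in `ℝⁿ`: the solution set of a finite system of linear inequalities
with rational coefficients and rational right-hand sides. -/
def IsRationalPolyhedron {n : ℕ} (S : Set (Fin n → ℝ)) : Prop :=
  ∃ (m : ℕ) (A : Fin m → Fin n → ℚ) (b : Fin m → ℚ),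
    S = {x | ∀ k, (b k : ℝ) ≤ ∑ i, (A k i : ℝ) * x i}

/-- The set `conv {vⁱ : i ∈ V} + cone {rʲ : j ∈ E}` for families of rational points `vⁱ` and
integer vectors `rʲ`. -/
def innerPolyhedron {n : ℕ} {V E : Type*} (v : V → Fin n → ℚ) (r : E → Fin n → ℤ) :
    Set (Fin n → ℝ) :=
  convexHull ℝ (Set.range fun (i : V) (k : Fin n) => (v i k : ℝ)) +
    (PointedCone.hull ℝ (Set.range fun (j : E) (k : Fin n) => (r j k : ℝ)) : Set (Fin n → ℝ))

/-- The lattice `ℤᵖ` as a subset of `ℝᵖ`. -/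
def integerPoints (p : ℕ) : Set (Fin p → ℝ) :=
  Set.range fun (z : Fin p → ℤ) (i : Fin p) => (z i : ℝ)

/-- A lattice point free convex set: a convex subset of `ℝᵖ` whose relative interior contains
no integer point. -/
def IsLatticeFreeConvex {p : ℕ} (C : Set (Fin p → ℝ)) : Prop :=
  Convex ℝ C ∧ intrinsicInterior ℝ C ∩ integerPoints p = ∅

/-- A split polyhedron in `ℝᵖ`: a rational polyhedron that is an inclusion-maximal lattice
point free convex set. -/
def IsSplitPolyhedron {p : ℕ} (S : Set (Fin p → ℝ)) : Prop :=
  IsRationalPolyhedron S ∧ Maximal IsLatticeFreeConvex S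

/-- A mixed integer split polyhedron in `ℝᵖ⁺ᑫ`, the first `p` coordinates being the integer
constrained ones: a set `{(x, y) ∈ ℝᵖ × ℝᑫ : x ∈ Lˣ}` with `Lˣ` a split polyhedron in `ℝᵖ`. -/
def IsMixedIntegerSplitPolyhedron (p q : ℕ) (L : Set (Fin (p + q) → ℝ)) : Prop :=
  ∃ S : Set (Fin p → ℝ), IsSplitPolyhedron S ∧
    L = {z | (fun i : Fin p => z (Fin.castAdd q i)) ∈ S}

/-- `πᵀ x ≥ π₀` is facet defining for `L`: it is valid for `L`, and the face of `L` on which it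
holds with equality is non-empty and has dimension one less than `L`. -/
def IsFacetDefining {n : ℕ} (L : Set (Fin n → ℝ)) (π : Fin n → ℤ) (π₀ : ℤ) : Prop :=
  (∀ x ∈ L, (π₀ : ℝ) ≤ ∑ i, (π i : ℝ) * x i) ∧
  {x ∈ L | ∑ i, (π i : ℝ) * x i = (π₀ : ℝ)}.Nonempty ∧
  Module.finrank ℝ (vectorSpan ℝ {x ∈ L | ∑ i, (π i : ℝ) * x i = (π₀ : ℝ)}) + 1 =
    Module.finrank ℝ (vectorSpan ℝ L)

/-- The normalization that makes the integral inequality `πᵀ x ≥ π₀` of a facet unique: the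
integers `π₀, π₁, …, πₙ` have no common divisor other than `±1`. -/
def IsNormalized {n : ℕ} (π : Fin n → ℤ) (π₀ : ℤ) : Prop :=
  ∀ d : ℤ, d ∣ π₀ → (∀ i, d ∣ π i) → IsUnit d

/-- The width `max {vᵀ x : x ∈ L} - min {vᵀ x : x ∈ L}` of `L` along `v`, as an extended real
number (`⊤` if `vᵀ x` is unbounded on `L`). -/
def width {n : ℕ} (L : Set (Fin n → ℝ)) (v : Fin n → ℤ) : EReal :=
  (⨆ x ∈ L, ((∑ i, (v i : ℝ) * x i : ℝ) : EReal)) -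
    (⨅ x ∈ L, ((∑ i, (v i : ℝ) * x i : ℝ) : EReal))

/-- The max-facet-width of `L`: the largest width of `L` along the normalized integral normal
of a facet of `L`. -/
def maxFacetWidth {n : ℕ} (L : Set (Fin n → ℝ)) : EReal :=
  ⨆ (π : Fin n → ℤ) (π₀ : ℤ) (_ : IsFacetDefining L π π₀ ∧ IsNormalized π π₀), width L π

/-- The set of all mixed integer split polyhedra with max-facet-width at most `w`. -/
def splitPolyhedraOfWidth (p q : ℕ) (w : ℝ) : Set (Set (Fin (p + q) → ℝ)) :=
  {L | IsMixedIntegerSplitPolyhedron p q L ∧ maxFacetWidth L ≤ (w : EReal)}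

/-- The relaxation `R(C, P) = conv {x ∈ P : x ∉ ri C}`. -/
def relaxation {n : ℕ} (C P : Set (Fin n → ℝ)) : Set (Fin n → ℝ) :=
  convexHull ℝ {x ∈ P | x ∉ intrinsicInterior ℝ C}

/-- The `w`-th split closure of `P`: the intersection of `R(L, P)` over all mixed integer split
polyhedra `L` with max-facet-width at most `w`. -/
def splitClosure (p q : ℕ) (w : ℝ) (P : Set (Fin (p + q) → ℝ)) : Set (Fin (p + q) → ℝ) :=
  ⋂ L ∈ splitPolyhedraOfWidth p q w, relaxation L P

end SplitClosure

end

/-! Homogenize: `P` is the slice at height one of the cone generated by the vectors `(1, vⁱ)` and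
`(0, rʲ)`. For a split polyhedron `L`, let `O` consist of all ray generators and of the vertex
generators outside `ri L`. Then `R(L, P)` is the slice of the cone generated by `O` and by the
points at which the segments and rays from a generator `a ∉ O` towards some `b ∈ O` first leave `ri
L` (`relaxation_eq_slice`). Such a point has the homogeneous form `g a + t • g b`, so `R(L, P)`
depends only on `O` and on finitely many exit parameters `t`.

Bounded width makes these parameters almost discrete. `L` is full-dimensional and is cut out by
facets with coprime integral coefficients, whose slack on `L` is at most `w`
(`exists_integral_description`). If `D` is a common denominator of the `vⁱ`, then `D` times any
slack of a generator is an integer. Hence `t = m / (N + 1)` with `m ≤ D w`: there are finitely many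
numerators, and only the denominators are unbounded (`exists_exitSet`).

Decreasing `t` enlarges the cone, because `g b` is itself a generator. So, for equal `O` and equal
numerators, componentwise smaller denominators give a smaller relaxation. By Dickson's lemma,
finitely many members of the family dominate all the others (`exists_finite_dominating`), and the
intersection reduces to finitely many slices, each a polyhedron by Fourier–Motzkin elimination
(`exists_finite_halfspaces_hull`). -/

namespace SplitClosure

/-! ### Finitely generated cones and Fourier–Motzkin elimination -/

section Cones

variable {M : Type*} [AddCommGroup M] [Module ℝ M]

theorem smul_mem_hull {S : Set M} {x : M} {c : ℝ} (hc : 0 ≤ c)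
    (hx : x ∈ PointedCone.hull ℝ S) : c • x ∈ PointedCone.hull ℝ S :=
  PointedCone.smul_mem _ hc hx

theorem hull_le_of_subset {S : Set M} {p : M → Prop} (h0 : p 0)
    (hadd : ∀ x y, p x → p y → p (x + y)) (hsmul : ∀ (c : ℝ) x, 0 ≤ c → p x → p (c • x))
    (hS : ∀ x ∈ S, p x) {x : M} (hx : x ∈ PointedCone.hull ℝ S) : p x := by
  refine Submodule.span_induction (p := fun x _ => p x) hS h0 (fun x y _ _ => hadd x y)
    (fun c x _ h => ?_) hx
  exact hsmul c x c.2 h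

theorem mem_hull_insert {g : M} {S : Set M} {x : M} :
    x ∈ PointedCone.hull ℝ (insert g S) ↔
      ∃ t : ℝ, 0 ≤ t ∧ x - t • g ∈ PointedCone.hull ℝ S := by
  constructor
  · intro hx
    obtain ⟨a, z, hz, rfl⟩ := Submodule.mem_span_insert.1 hx
    refine ⟨a, a.2, ?_⟩
    have : a • g + z - (a : ℝ) • g = z := by
      change (a : ℝ) • g + z - (a : ℝ) • g = z
      abel
    rw [this]
    exact hz
  · rintro ⟨t, ht, hz⟩
    exact Submodule.mem_span_insert.2 ⟨⟨t, ht⟩, _, hz, by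
      change x = t • g + (x - t • g)
      abel⟩

theorem exists_between_of_finite {s t : Set ℝ} (hs : s.Finite)
    (ht : ∀ u ∈ t, 0 ≤ u) (h : ∀ l ∈ s, ∀ u ∈ t, l ≤ u) :
    ∃ c : ℝ, 0 ≤ c ∧ (∀ l ∈ s, l ≤ c) ∧ ∀ u ∈ t, c ≤ u := by
  -- Adjoining `0` forces `0 ≤ c` and covers the case of empty `s`.
  obtain ⟨c, hc, hmax⟩ := (hs.insert 0).exists_maximal (Set.insert_nonempty 0 s)
  have hle : ∀ l ∈ insert 0 s, l ≤ c := fun l hl => by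
    rcases le_total l c with h | h
    · exact h
    · exact hmax hl h
  refine ⟨c, hle 0 (Set.mem_insert _ _), fun l hl => hle l (Set.mem_insert_of_mem _ hl), ?_⟩
  rcases hc with rfl | hc
  · exact ht
  · exact h c hc

/-- One step of Fourier–Motzkin elimination. -/
theorem exists_finite_halfspaces_insert {g : M} {K K' : Set M} {F : Set (Module.Dual ℝ M)}
    (hF : F.Finite) (hK : ∀ x, x ∈ K ↔ ∀ f ∈ F, 0 ≤ f x)
    (hK' : ∀ x, x ∈ K' ↔ ∃ t : ℝ, 0 ≤ t ∧ x - t • g ∈ K) :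
    ∃ F' : Set (Module.Dual ℝ M), F'.Finite ∧ ∀ x, x ∈ K' ↔ ∀ f ∈ F', 0 ≤ f x := by
  -- In `f x - t * f g ≥ 0`, functionals with `f g > 0` bound `t` from above and those with `f g <
  -- 0` from below. The first family makes the upper bounds nonnegative (and keeps the constraints
  -- with `f g = 0`); the second, whose members vanish at `g`, puts every lower bound below every
  -- upper bound.
  refine ⟨{f ∈ F | 0 ≤ f g} ∪
    (fun p : Module.Dual ℝ M × Module.Dual ℝ M => p.1 g • p.2 - p.2 g • p.1) ''
      ({f ∈ F | 0 ≤ f g} ×ˢ {f ∈ F | f g ≤ 0}), ?_, fun x => ?_⟩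
  · exact (hF.subset (Set.sep_subset _ _)).union
      (((hF.subset (Set.sep_subset _ _)).prod (hF.subset (Set.sep_subset _ _))).image _)
  rw [hK']
  constructor
  · rintro ⟨t, ht, hx⟩ f hf
    rw [hK] at hx
    have hx' : ∀ f ∈ F, 0 ≤ f x - t * f g := fun f hf => by simpa using hx f hf
    rcases hf with ⟨hf, hfg⟩ | ⟨⟨u, l⟩, ⟨⟨hu, hug⟩, hl, hlg⟩, rfl⟩
    · nlinarith [hx' f hf]
    · have h1 := hx' u hu
      have h2 := hx' l hl
      simp only [LinearMap.sub_apply, LinearMap.smul_apply, smul_eq_mul] at *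
      nlinarith [mul_nonneg hug h2, mul_nonneg (neg_nonneg.2 hlg) h1]
  · intro h
    have h1 : ∀ f ∈ F, 0 ≤ f g → 0 ≤ f x := fun f hf hg => h f (Or.inl ⟨hf, hg⟩)
    have h2 : ∀ u ∈ F, ∀ l ∈ F, 0 ≤ u g → l g ≤ 0 → 0 ≤ u g * l x - l g * u x :=
      fun u hu l hl hug hlg => by
        simpa using h _ (Or.inr ⟨(u, l), ⟨⟨hu, hug⟩, hl, hlg⟩, rfl⟩)
    obtain ⟨t, ht, hlo, hup⟩ := exists_between_of_finite
      (s := (fun f : Module.Dual ℝ M => f x / f g) '' {f ∈ F | f g < 0})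
      (t := (fun f : Module.Dual ℝ M => f x / f g) '' {f ∈ F | 0 < f g})
      ((hF.subset (Set.sep_subset _ _)).image _)
      (by
        rintro _ ⟨f, ⟨hf, hfg⟩, rfl⟩
        exact div_nonneg (h1 f hf hfg.le) hfg.le)
      (by
        rintro _ ⟨l, ⟨hl, hlg⟩, rfl⟩ _ ⟨u, ⟨hu, hug⟩, rfl⟩
        have := h2 u hu l hl hug.le hlg.le
        have hlg' : l g < 0 := hlg
        have hug' : 0 < u g := hug
        change l x / l g ≤ u x / u g
        rw [div_le_iff_of_neg hlg', div_mul_eq_mul_div, div_le_iff₀ hug']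
        linarith)
    refine ⟨t, ht, (hK _).2 fun f hf => ?_⟩
    have e : f (x - t • g) = f x - t * f g := by simp
    rw [e]
    rcases lt_trichotomy (f g) 0 with hg | hg | hg
    · have := hlo _ ⟨f, ⟨hf, hg⟩, rfl⟩
      have := (div_le_iff_of_neg hg).1 this
      linarith
    · have := h1 f hf hg.ge
      rw [hg]; linarith
    · have := hup _ ⟨f, ⟨hf, hg⟩, rfl⟩
      have := (le_div_iff₀ hg).1 this
      linarith

/-- A finitely generated cone in a finite dimensional space is a finite intersection of
half-spaces. -/
theorem exists_finite_halfspaces_hull [FiniteDimensional ℝ M] {S : Set M} (hS : S.Finite) :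
    ∃ F : Set (Module.Dual ℝ M), F.Finite ∧
      ∀ x, x ∈ PointedCone.hull ℝ S ↔ ∀ f ∈ F, 0 ≤ f x := by
  induction S, hS using Set.Finite.induction_on with
  | empty =>
    let b := Module.finBasis ℝ M
    refine ⟨Set.range b.coord ∪ Set.range fun i => -b.coord i,
      (Set.finite_range _).union (Set.finite_range _), fun x => ?_⟩
    constructor
    · intro hx
      have hx : x = 0 := by simpa [PointedCone.hull] using hx
      simp [hx]
    · intro h
      have : x = 0 := by
        refine b.ext_elem fun i => ?_
        have h1 := h _ (Or.inl ⟨i, rfl⟩)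
        have h2 := h _ (Or.inr ⟨i, rfl⟩)
        simp only [LinearMap.neg_apply, Module.Basis.coord_apply] at h1 h2
        simp only [map_zero, Finsupp.coe_zero, Pi.zero_apply]
        linarith
      rw [this]
      exact zero_mem _
  | @insert a s _ _ ih =>
    obtain ⟨F, hF, h⟩ := ih
    exact exists_finite_halfspaces_insert (K := (PointedCone.hull ℝ s : Set M))
      (K' := (PointedCone.hull ℝ (insert a s) : Set M)) hF h fun x => mem_hull_insert

/-- Elements of a cone in a half-space are generated by the generators in the half-space together
with the points in which the segments between the generators cross the bounding hyperplane. -/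
theorem mem_of_mem_hull_of_nonpos {S : Set M} {K : PointedCone ℝ M} {f : Module.Dual ℝ M}
    (h1 : ∀ a ∈ S, f a ≤ 0 → a ∈ K)
    (h2 : ∀ a ∈ S, ∀ b ∈ S, 0 < f a → f b ≤ 0 → (-f b) • a + f a • b ∈ K)
    {x : M} (hx : x ∈ PointedCone.hull ℝ S) (hfx : f x ≤ 0) : x ∈ K := by
  have hK : ∀ (c : ℝ) y, 0 ≤ c → y ∈ K → c • y ∈ K := fun c y hc hy => PointedCone.smul_mem K hc hy
  have hS : S = {a ∈ S | 0 < f a} ∪ {a ∈ S | f a ≤ 0} := by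
    ext a
    rcases lt_or_ge 0 (f a) with h | h <;> simp [h, not_lt.2, not_le.2]
  rw [hS] at hx
  obtain ⟨y, hy, z, hz, rfl⟩ :=
    Submodule.mem_sup.1 ((Submodule.span_union _ _).le hx)
  have hy0 : y = 0 ∨ 0 < f y := by
    refine hull_le_of_subset (p := fun y => y = 0 ∨ 0 < f y) (Or.inl rfl) ?_ ?_
      (fun a ha => Or.inr ha.2) hy
    · rintro a b (rfl | ha) (rfl | hb)
      · simp
      · simpa using Or.inr hb
      · simpa using Or.inr ha
      · exact Or.inr (by rw [map_add]; positivity)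
    · rintro c a hc (rfl | ha)
      · simp
      · rcases hc.eq_or_lt with rfl | hc
        · simp
        · exact Or.inr (by rw [map_smul, smul_eq_mul]; positivity)
  have hzK : z ∈ K := hull_le_of_subset (p := (· ∈ K)) K.zero_mem (fun _ _ => K.add_mem) hK
    (fun a ha => h1 a ha.1 ha.2) hz
  -- The expression is bilinear in `(y, z)`, so it suffices to check pairs of generators.
  have hyz : (-f z) • y + f y • z ∈ K := by
    refine hull_le_of_subset (p := fun y => (-f z) • y + f y • z ∈ K) (by simp) ?_ ?_ ?_ hy
    · intro a b ha hb
      convert K.add_mem ha hb using 1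
      simp only [map_add]
      module
    · intro c a hc ha
      convert hK c _ hc ha using 1
      simp only [map_smul, smul_eq_mul]
      module
    · intro a ha
      refine hull_le_of_subset (p := fun z => (-f z) • a + f a • z ∈ K) (by simp) ?_ ?_ ?_ hz
      · intro z w hz hw
        convert K.add_mem hz hw using 1
        simp only [map_add]
        module
      · intro c z hc hz
        convert hK c _ hc hz using 1
        simp only [map_smul, smul_eq_mul]
        module
      · intro b hb
        exact h2 a ha.1 b hb.1 ha.2 hb.2
  rcases hy0 with rfl | hy0
  · simpa using hzK
  · rw [map_add] at hfx
    have hpos : 0 < -f z := by linarith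
    have : (-f z) • (y + z) ∈ K := by
      convert K.add_mem hyz (hK (-f z - f y) z (by linarith) hzK) using 1
      module
    have := hK (-f z)⁻¹ _ (by positivity) this
    rwa [smul_smul, inv_mul_cancel₀ hpos.ne', one_smul] at this

/-- A point of height one in a homogenized cone lies in a convex set that is stable under a cone of
directions, if all the generators do. -/
theorem mem_of_one_mem_hull {S : Set (ℝ × M)} {R : Set M} {C : PointedCone ℝ M}
    (hR : Convex ℝ R) (hRC : ∀ x ∈ R, ∀ c ∈ C, x + c ∈ R)
    (hS : ∀ a ∈ S, (a.1 = 0 ∧ a.2 ∈ C) ∨ (0 < a.1 ∧ a.1⁻¹ • a.2 ∈ R)) {x : M}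
    (hx : ((1 : ℝ), x) ∈ PointedCone.hull ℝ S) : x ∈ R := by
  have hC : ∀ (c : ℝ) y, 0 ≤ c → y ∈ C → c • y ∈ C := fun c y hc hy => PointedCone.smul_mem C hc hy
  have key := hull_le_of_subset
    (p := fun a : ℝ × M => (a.1 = 0 ∧ a.2 ∈ C) ∨ (0 < a.1 ∧ a.1⁻¹ • a.2 ∈ R))
    (Or.inl ⟨rfl, C.zero_mem⟩) ?_ ?_ hS hx
  · simpa using key
  · rintro ⟨s, y⟩ ⟨t, z⟩ (⟨hs, hy⟩ | ⟨hs, hy⟩) (⟨ht, hz⟩ | ⟨ht, hz⟩) <;>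
      simp only [Prod.mk_add_mk] at *
    · exact Or.inl ⟨by rw [hs, ht, add_zero], C.add_mem hy hz⟩
    · refine Or.inr ⟨by rw [hs, zero_add]; exact ht, ?_⟩
      rw [hs, zero_add, smul_add, add_comm]
      exact hRC _ hz _ (hC _ _ (by positivity) hy)
    · refine Or.inr ⟨by rw [ht, add_zero]; exact hs, ?_⟩
      rw [ht, add_zero, smul_add]
      exact hRC _ hy _ (hC _ _ (by positivity) hz)
    · refine Or.inr ⟨by positivity, ?_⟩
      convert hR hy hz (a := s / (s + t)) (b := t / (s + t)) (by positivity) (by positivity)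
        (by field_simp) using 1
      rw [smul_smul, smul_smul, smul_add]
      congr 2 <;> field_simp
  · rintro c ⟨t, y⟩ hc (⟨ht, hy⟩ | ⟨ht, hy⟩) <;> simp only [Prod.smul_mk, smul_eq_mul] at *
    · exact Or.inl ⟨by rw [ht, mul_zero], hC c y hc hy⟩
    · rcases hc.eq_or_lt with rfl | hc
      · exact Or.inl ⟨by simp, by simp⟩
      · refine Or.inr ⟨by positivity, ?_⟩
        convert hy using 1
        rw [smul_smul]
        congr 1
        field_simp

end Cones

/-! ### Slices at height one -/

theorem isPolyhedron_of_finite {n : ℕ} {F : Set (Module.Dual ℝ (ℝ × (Fin n → ℝ)))}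
    (hF : F.Finite) : IsPolyhedron {x : Fin n → ℝ | ∀ f ∈ F, 0 ≤ f (1, x)} := by
  obtain ⟨m, e, he⟩ := hF.fin_param
  refine ⟨m, fun k i => e k (0, Pi.single i 1), fun k => -e k (1, 0), ?_⟩
  ext x
  have hx : ∀ f : Module.Dual ℝ (ℝ × (Fin n → ℝ)),
      f (1, x) = f (1, 0) + ∑ i, f (0, Pi.single i 1) * x i := fun f => by
    have h0 : ((1 : ℝ), x) = (1, 0) + ∑ i, x i • ((0 : ℝ), (Pi.single i 1 : Fin n → ℝ)) := by
      refine Prod.ext ?_ ?_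
      · simp [Prod.fst_sum]
      · simp only [Prod.snd_add, Prod.snd_sum, Prod.smul_mk, zero_add]
        exact pi_eq_sum_univ' x
    rw [h0, map_add, map_sum]
    simp only [map_smul, smul_eq_mul, mul_comm]
  simp only [Set.mem_ofPred_eq, he.2.symm ▸ Set.forall_mem_range, hx]
  exact forall_congr' fun k => by constructor <;> intro h <;> linarith

/-- A finite intersection of slices of finitely generated cones is a polyhedron. -/
theorem isPolyhedron_iInter_slice_hull {n : ℕ} {ι : Type*} (J : Finset ι)
    {S : ι → Set (ℝ × (Fin n → ℝ))} (hS : ∀ i, (S i).Finite) :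
    IsPolyhedron (⋂ i ∈ J, {x : Fin n → ℝ | ((1 : ℝ), x) ∈ PointedCone.hull ℝ (S i)}) := by
  choose F hF h using fun i => exists_finite_halfspaces_hull (hS i)
  convert isPolyhedron_of_finite (F := ⋃ i ∈ J, F i) (J.finite_toSet.biUnion fun i _ => hF i)
    using 1
  ext x
  simp only [Set.mem_iInter, Set.mem_ofPred_eq, h, Set.mem_iUnion, exists_prop,
    forall_exists_index, and_imp]
  exact ⟨fun H f i hi hf => H i hi f hf, fun H i hi f hf => H f i hi hf⟩

/-- The linear functional with coefficient vector `a`. -/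
def linearForm {n : ℕ} (a : Fin n → ℝ) : Module.Dual ℝ (Fin n → ℝ) :=
  ∑ i, a i • LinearMap.proj i

theorem linearForm_apply {n : ℕ} (a x : Fin n → ℝ) : linearForm a x = ∑ i, a i * x i := by
  simp [linearForm]

theorem linearForm_smul {n : ℕ} (c : ℝ) (a x : Fin n → ℝ) :
    linearForm (c • a) x = c * linearForm a x := by
  simp [linearForm_apply, Finset.mul_sum, mul_assoc]

theorem exists_linearForm_eq_one {n : ℕ} {a : Fin n → ℝ} (ha : a ≠ 0) :
    ∃ z, linearForm a z = 1 := by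
  obtain ⟨i, hi⟩ := Function.ne_iff.1 ha
  refine ⟨Pi.single i (a i)⁻¹, ?_⟩
  rw [linearForm_apply, Finset.sum_eq_single i]
  · simpa using mul_inv_cancel₀ hi
  · intro j _ hj
    simp [hj]
  · simp

theorem linearForm_ne_zero {n : ℕ} {a : Fin n → ℝ} (ha : a ≠ 0) : linearForm a ≠ 0 := by
  obtain ⟨z, hz⟩ := exists_linearForm_eq_one ha
  rintro h
  simp [h] at hz

/-! ### Relative interiors -/

section IntrinsicInterior

variable {W : Type*} [NormedAddCommGroup W] [NormedSpace ℝ W] {C : Set W} {y s : W}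

theorem mem_intrinsicInterior_iff_dist :
    y ∈ intrinsicInterior ℝ C ↔
      y ∈ C ∧ ∃ δ > 0, ∀ z ∈ affineSpan ℝ C, dist z y < δ → z ∈ C := by
  rw [mem_intrinsicInterior]
  constructor
  · rintro ⟨y, hy, rfl⟩
    obtain ⟨δ, hδ, h⟩ := Metric.mem_nhds_iff.1 (mem_interior_iff_mem_nhds.1 hy)
    exact ⟨interior_subset (s := (Subtype.val ⁻¹' C : Set (affineSpan ℝ C))) hy, δ, hδ, fun z hz hd => @h ⟨z, hz⟩ hd⟩
  · rintro ⟨hy, δ, hδ, h⟩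
    refine ⟨⟨y, subset_affineSpan ℝ C hy⟩, ?_, rfl⟩
    exact mem_interior_iff_mem_nhds.2 (Metric.mem_nhds_iff.2 ⟨δ, hδ, fun z hz => h z z.2 hz⟩)

/-- The line through `y` and `s` stays in the affine span, so a relative interior point can be
pushed slightly further away from any point of `C`. -/
theorem exists_pos_add_smul_sub_mem (hy : y ∈ intrinsicInterior ℝ C) (hs : s ∈ C) :
    ∃ ε > (0 : ℝ), y + ε • (y - s) ∈ C := by
  obtain ⟨hyC, δ, hδ, h⟩ := mem_intrinsicInterior_iff_dist.1 hy
  have hpos : 0 < ‖y - s‖ + 1 := by positivity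
  refine ⟨δ / 2 / (‖y - s‖ + 1), by positivity, h _ ?_ ?_⟩
  · have := AffineMap.lineMap_mem (-(δ / 2 / (‖y - s‖ + 1))) (subset_affineSpan ℝ C hyC)
      (subset_affineSpan ℝ C hs)
    convert this using 1
    rw [AffineMap.lineMap_apply_module']
    module
  · rw [dist_eq_norm, add_sub_cancel_left, norm_smul, Real.norm_of_nonneg (by positivity),
      div_mul_eq_mul_div, div_lt_iff₀ hpos]
    nlinarith [norm_nonneg (y - s)]

end IntrinsicInterior

/-! ### Maximal lattice point free sets are full-dimensional -/

section LatticeFree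

variable {p : ℕ} {S : Set (Fin p → ℝ)}

theorem nonempty_of_maximal_isLatticeFreeConvex (hp : 0 < p)
    (hS : Maximal IsLatticeFreeConvex S) : S.Nonempty := by
  by_contra hne
  rw [Set.not_nonempty_iff_eq_empty] at hne
  -- For `p > 0` a non-integral singleton is a lattice point free set strictly larger than `∅`.
  have h : IsLatticeFreeConvex ({fun _ => 1 / 2} : Set (Fin p → ℝ)) := by
    refine ⟨convex_singleton _, ?_⟩
    rw [intrinsicInterior_singleton, Set.singleton_inter_eq_empty]
    rintro ⟨z, hz⟩
    have h1 : ((z ⟨0, hp⟩ : ℤ) : ℝ) = 1 / 2 := congrFun hz ⟨0, hp⟩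
    have h2 : (2 * z ⟨0, hp⟩ : ℤ) = 1 := by
      have : (2 * z ⟨0, hp⟩ : ℝ) = 1 := by linarith
      exact_mod_cast this
    omega
  have := hS.2 h (by rw [hne]; exact Set.empty_subset _) rfl
  rw [hne] at this
  exact this

/-- A maximal lattice point free convex set is not contained in a rational hyperplane. -/
theorem exists_linearForm_ne_of_maximal_isLatticeFreeConvex (hp : 0 < p)
    (hS : Maximal IsLatticeFreeConvex S) {a : Fin p → ℤ} (ha : a ≠ 0) (β : ℤ) :
    ∃ x ∈ S, linearForm (fun i => (a i : ℝ)) x ≠ β := by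
  by_contra! hβ
  have ha' : (fun i => (a i : ℝ)) ≠ 0 := fun h =>
    ha (funext fun i => Int.cast_eq_zero.1 (congrFun h i))
  obtain ⟨z, hz⟩ := exists_linearForm_eq_one ha'
  set f := linearForm fun i => (a i : ℝ) with hf
  obtain ⟨s₀, hs₀⟩ := nonempty_of_maximal_isLatticeFreeConvex hp hS
  -- If `f = β` on `S`, thicken `S` to the slab piece `T` on which `|f - β| ≤ 1`. Relative interior
  -- points of `T` satisfy this strictly, and `f` is integral on lattice points, so a lattice point
  -- in `ri T` would already lie in `ri S`. Thus `T` contradicts maximality.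
  set T : Set (Fin p → ℝ) := S + segment ℝ (-z) z
  have hmem : ∀ s ∈ S, ∀ t : ℝ, -1 ≤ t → t ≤ 1 → s + t • z ∈ T := fun s hs t h1 h2 =>
    Set.add_mem_add hs ⟨(1 - t) / 2, (1 + t) / 2, by linarith, by linarith, by ring, by module⟩
  have hT' : ∀ y ∈ T, ∃ s ∈ S, ∃ t : ℝ, -1 ≤ t ∧ t ≤ 1 ∧ y = s + t • z := by
    rintro _ ⟨s, hs, _, ⟨b, c, hb, hc, hbc, rfl⟩, rfl⟩
    exact ⟨s, hs, c - b, by linarith, by linarith, by dsimp only; module⟩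
  have hfT : ∀ s ∈ S, ∀ t : ℝ, f (s + t • z) = β + t := fun s hs t => by
    rw [map_add, map_smul, hβ s hs, hz, smul_eq_mul, mul_one]
  have hST : S ⊆ T := fun s hs => by simpa using hmem s hs 0 (by norm_num) (by norm_num)
  have hfree : IsLatticeFreeConvex T := by
    refine ⟨hS.1.1.add (convex_segment _ _), ?_⟩
    rw [Set.eq_empty_iff_forall_notMem]
    rintro y ⟨hy, hyZ⟩
    obtain ⟨s, hs, t, ht1, ht2, hyst⟩ := hT' y (intrinsicInterior_subset hy)
    have hbound : ∀ x ∈ T, (β : ℝ) - 1 ≤ f x ∧ f x ≤ β + 1 := fun x hx => by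
      obtain ⟨s, hs, t, h1, h2, rfl⟩ := hT' x hx
      rw [hfT s hs]
      constructor <;> linarith
    have h1 : t < 1 := by
      obtain ⟨ε, hε, h⟩ := exists_pos_add_smul_sub_mem hy (hST hs)
      have := (hbound _ h).2
      rw [hyst, add_sub_cancel_left, smul_smul, add_assoc, ← add_smul, hfT s hs] at this
      nlinarith
    have h2 : -1 < t := by
      obtain ⟨ε, hε, h⟩ := exists_pos_add_smul_sub_mem hy (hST hs)
      have := (hbound _ h).1
      rw [hyst, add_sub_cancel_left, smul_smul, add_assoc, ← add_smul, hfT s hs] at this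
      nlinarith
    obtain ⟨k, rfl⟩ := hyZ
    dsimp only at hy hyst
    have hk : f (fun i => (k i : ℝ)) = ((∑ i, a i * k i : ℤ) : ℝ) := by
      rw [hf, linearForm_apply]
      push_cast
      rfl
    have ht : t = 0 := by
      have h3 : ((∑ i, a i * k i - β : ℤ) : ℝ) = t := by
        have := hfT s hs t
        rw [← hyst, hk] at this
        push_cast at this ⊢
        linarith
      rw [← h3] at h1 h2 ⊢
      have h1' : (∑ i, a i * k i - β : ℤ) < 1 := by exact_mod_cast h1
      have h2' : -1 < (∑ i, a i * k i - β : ℤ) := by exact_mod_cast h2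
      have : (∑ i, a i * k i - β : ℤ) = 0 := by omega
      exact_mod_cast this
    have hsy : (fun i => (k i : ℝ)) = s := by rw [hyst, ht]; simp
    -- Near this point `aff S` stays inside `T`, and `f = β` on `aff S` leaves only the part of `T`
    -- without displacement along `z`, which is `S`.
    have hyS : (fun i => (k i : ℝ)) ∈ intrinsicInterior ℝ S := by
      obtain ⟨-, δ, hδ, h⟩ := mem_intrinsicInterior_iff_dist.1 hy
      refine mem_intrinsicInterior_iff_dist.2 ⟨hsy ▸ hs, δ, hδ, fun x hx hd => ?_⟩
      obtain ⟨s', hs', t', -, -, rfl⟩ := hT' x (h x (affineSpan_mono ℝ hST hx) hd)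
      have hfx : f (s' + t' • z) = β := by
        refine affineSpan_induction (p := fun x => f x = β) hx hβ ?_
        intro c u v w hu hv hw
        simp only [vsub_eq_sub, vadd_eq_add, map_add, map_smul, map_sub, hu, hv, hw, sub_self,
          smul_zero, zero_add]
      rw [hfT s' hs'] at hfx
      have : t' = 0 := by linarith
      simpa [this] using hs'
    have := hS.1.2
    rw [Set.eq_empty_iff_forall_notMem] at this
    exact this _ ⟨hyS, k, rfl⟩
  have h1 := hS.2 hfree hST (hmem s₀ hs₀ 1 (by norm_num) le_rfl)
  have h2 := hβ _ h1
  rw [hfT s₀ hs₀] at h2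
  linarith

end LatticeFree

/-- A rational inequality has a positive multiple with coprime integral coefficients. -/
theorem exists_isNormalized_multiple {n : ℕ} {a : Fin n → ℚ} (ha : a ≠ 0) (b : ℚ) :
    ∃ (c : ℚ) (π : Fin n → ℤ) (π₀ : ℤ), 0 < c ∧ (∀ i, (π i : ℚ) = c * a i) ∧ (π₀ : ℚ) = c * b ∧
      IsNormalized π π₀ := by
  -- The index `none` carries the right-hand side, so that the gcd runs over all `n + 1` numbers.
  let u : Option (Fin n) → ℚ := fun o => o.elim b a
  obtain ⟨D, hD⟩ := IsLocalization.exist_integer_multiples_of_finset (nonZeroDivisors ℤ)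
    (Finset.univ.image u)
  have hD0 : (D : ℤ) ≠ 0 := nonZeroDivisors.coe_ne_zero D
  have hu : ∀ o, ∃ z : ℤ, (z : ℚ) = |((D : ℤ) : ℚ)| * u o := fun o => by
    obtain ⟨z, hz⟩ := hD (u o) (Finset.mem_image_of_mem _ (Finset.mem_univ _))
    rcases abs_choice ((D : ℤ) : ℚ) with h | h
    · exact ⟨z, by rw [h]; simpa using hz⟩
    · refine ⟨-z, ?_⟩
      rw [h]
      simpa using hz
  choose z hz using hu
  obtain ⟨g, hg, hgcd⟩ := Finset.extract_gcd z (Finset.univ_nonempty (α := Option (Fin n)))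
  set d : ℤ := Finset.univ.gcd z with hd
  obtain ⟨i, hi⟩ := Function.ne_iff.1 ha
  have hDpos : 0 < |((D : ℤ) : ℚ)| := abs_pos.2 (by exact_mod_cast hD0)
  have hd0 : d ≠ 0 := by
    intro h0
    have h1 := hg (some i) (Finset.mem_univ _)
    have h2 := hz (some i)
    rw [h1, h0] at h2
    simp only [zero_mul, Int.cast_zero] at h2
    exact (mul_ne_zero hDpos.ne' hi) h2.symm
  have hdpos : 0 < d := lt_of_le_of_ne
    (by
      have : normalize d = d := Finset.normalize_gcd
      rw [← this, ← Int.abs_eq_normalize]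
      exact abs_nonneg d) hd0.symm
  have hdQ : (0 : ℚ) < d := by exact_mod_cast hdpos
  have key : ∀ o, (g o : ℚ) = |((D : ℤ) : ℚ)| / d * u o := fun o => by
    have h1 : (z o : ℚ) = d * g o := by exact_mod_cast hg o (Finset.mem_univ _)
    rw [hz o] at h1
    field_simp
    linarith
  refine ⟨|((D : ℤ) : ℚ)| / d, fun i => g (some i), g none, by positivity,
    fun i => key (some i), key none, fun e he0 he => ?_⟩
  rw [isUnit_iff_dvd_one, ← hgcd]
  refine Finset.dvd_gcd fun o _ => ?_
  cases o with
  | none => exact he0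
  | some i => exact he i

/-! ### Irredundant systems and their facets -/

section Facets

variable {n : ℕ} {ι : Type*} {J : Finset ι} {a : ι → Fin n → ℝ} {b : ι → ℝ}

theorem exists_pos_forall_lt_add_smul {z : Fin n → ℝ} (hz : ∀ k ∈ J, b k < linearForm (a k) z)
    (d : Fin n → ℝ) : ∃ ε > (0 : ℝ), ∀ k ∈ J, b k < linearForm (a k) (z + ε • d) := by
  have h : ∀ᶠ ε : ℝ in nhdsWithin 0 (Set.Ioi 0),
      0 < ε ∧ ∀ k ∈ J, b k < linearForm (a k) (z + ε • d) := by
    refine Filter.Eventually.and self_mem_nhdsWithin ?_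
    rw [Filter.eventually_all_finset]
    intro k hk
    have hc : Continuous fun ε : ℝ => linearForm (a k) (z + ε • d) := by
      simp only [map_add, map_smul]
      fun_prop
    refine nhdsWithin_le_nhds ((hc.tendsto 0).eventually (lt_mem_nhds ?_))
    simpa using hz k hk
  obtain ⟨ε, h0, h1⟩ := h.exists
  exact ⟨ε, h0, h1⟩

theorem vectorSpan_eq_top_of_strict {x₀ : Fin n → ℝ} (h : ∀ k ∈ J, b k < linearForm (a k) x₀) :
    vectorSpan ℝ {x | ∀ k ∈ J, b k ≤ linearForm (a k) x} = ⊤ := by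
  refine eq_top_iff.2 fun d _ => ?_
  obtain ⟨ε, hε, hd⟩ := exists_pos_forall_lt_add_smul h d
  have := vsub_mem_vectorSpan ℝ (s := {x | ∀ k ∈ J, b k ≤ linearForm (a k) x})
    (p₁ := x₀ + ε • d) (p₂ := x₀) (fun k hk => (hd k hk).le) (fun k hk => (h k hk).le)
  rw [vsub_eq_sub, add_sub_cancel_left] at this
  exact (Submodule.smul_mem_iff _ hε.ne').1 this

/-- An inequality tight at a relative interior point would be violated after a small step away from
`x₀`; conversely, the strict system defines an open set. -/
theorem intrinsicInterior_eq_of_strict {x₀ : Fin n → ℝ}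
    (h : ∀ k ∈ J, b k < linearForm (a k) x₀) :
    intrinsicInterior ℝ {x | ∀ k ∈ J, b k ≤ linearForm (a k) x} =
      {x | ∀ k ∈ J, b k < linearForm (a k) x} := by
  refine Set.Subset.antisymm (fun x hx k hk => ?_) ?_
  · obtain ⟨ε, hε, hd⟩ := exists_pos_add_smul_sub_mem hx (s := x₀) fun k hk => (h k hk).le
    have h1 := hd k hk
    have h2 := h k hk
    simp only [map_add, map_smul, map_sub, smul_eq_mul] at h1
    by_contra hlt
    nlinarith
  · refine subset_trans (interior_maximal (fun x hx k hk => (hx k hk).le) ?_)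
      interior_subset_intrinsicInterior
    have : {x | ∀ k ∈ J, b k < linearForm (a k) x} =
        ⋂ k ∈ J, {x | b k < linearForm (a k) x} := by ext; simp
    rw [this]
    refine isOpen_biInter_finset fun k _ => isOpen_lt continuous_const ?_
    exact (linearForm (a k)).continuous_of_finiteDimensional

/-- Every inequality of an irredundant system with a strict solution attains equality at a point at
which all the others are strict. -/
theorem exists_mem_face_of_irredundant [DecidableEq ι] {x₀ y : Fin n → ℝ} {k : ι}
    (h : ∀ k ∈ J, b k < linearForm (a k) x₀) (hk : k ∈ J)
    (hy : ∀ l ∈ J.erase k, b l ≤ linearForm (a l) y) (hyk : linearForm (a k) y < b k) :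
    ∃ z, linearForm (a k) z = b k ∧ ∀ l ∈ J.erase k, b l < linearForm (a l) z := by
  have hx := h k hk
  set u := linearForm (a k) x₀ - b k with hu
  set v := b k - linearForm (a k) y with hv
  have hu0 : 0 < u := by linarith
  have hv0 : 0 < v := by linarith
  -- The weights place the point where the segment from `x₀` to `y` meets the `k`-th hyperplane; the
  -- positive weight of `x₀` keeps the other inequalities strict.
  refine ⟨(v / (u + v)) • x₀ + (u / (u + v)) • y, ?_, fun l hl => ?_⟩
  · simp only [map_add, map_smul, smul_eq_mul]
    have h1 : linearForm (a k) x₀ = b k + u := by rw [hu]; ring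
    have h2 : linearForm (a k) y = b k - v := by rw [hv]; ring
    rw [h1, h2]
    field_simp
    ring
  · simp only [map_add, map_smul, smul_eq_mul]
    have h1 := h l (Finset.mem_of_mem_erase hl)
    have h2 := hy l hl
    have h3 : b l = v / (u + v) * b l + u / (u + v) * b l := by field_simp; ring
    rw [h3]
    have h4 : 0 < v / (u + v) := by positivity
    have h5 : 0 < u / (u + v) := by positivity
    nlinarith [mul_lt_mul_of_pos_left h1 h4, mul_le_mul_of_nonneg_left h2 h5.le]

/-- Near `z` only the `k`-th inequality is active, so the face allows small moves in every direction
of the kernel of the form. -/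
theorem finrank_vectorSpan_face [DecidableEq ι] {z : Fin n → ℝ} {k : ι}
    (ha : a k ≠ 0) (hzk : linearForm (a k) z = b k)
    (hz : ∀ l ∈ J.erase k, b l < linearForm (a l) z) :
    Module.finrank ℝ (vectorSpan ℝ
      {x ∈ {x | ∀ k ∈ J, b k ≤ linearForm (a k) x} | linearForm (a k) x = b k}) + 1 = n := by
  have hspan : vectorSpan ℝ
      {x ∈ {x | ∀ k ∈ J, b k ≤ linearForm (a k) x} | linearForm (a k) x = b k} =
        LinearMap.ker (linearForm (a k)) := by
    apply le_antisymm
    · refine Submodule.span_le.2 ?_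
      rintro _ ⟨x, hx, y, hy, rfl⟩
      have h1 : linearForm (a k) x = b k := hx.2
      have h2 : linearForm (a k) y = b k := hy.2
      simp [h1, h2]
    · intro d hd
      rw [LinearMap.mem_ker] at hd
      obtain ⟨ε, hε, hεd⟩ := exists_pos_forall_lt_add_smul hz d
      have hmem : ∀ t : ℝ, (∀ l ∈ J.erase k, b l < linearForm (a l) (z + t • d)) →
          z + t • d ∈
            {x ∈ {x | ∀ k ∈ J, b k ≤ linearForm (a k) x} | linearForm (a k) x = b k} := by
        intro t ht
        have heq : linearForm (a k) (z + t • d) = b k := by simp [hd, hzk]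
        refine ⟨fun l hl => ?_, heq⟩
        by_cases hlk : l = k
        · rw [hlk, heq]
        · exact (ht l (Finset.mem_erase.2 ⟨hlk, hl⟩)).le
      have := vsub_mem_vectorSpan ℝ (hmem ε hεd) (hmem 0 (by simpa using hz))
      rw [vsub_eq_sub, zero_smul, add_zero, add_sub_cancel_left] at this
      exact (Submodule.smul_mem_iff _ hε.ne').1 this
  rw [hspan, Module.Dual.finrank_ker_add_one_of_ne_zero (linearForm_ne_zero ha)]
  simp

/-- Every finite system of linear inequalities contains an irredundant equivalent subsystem. -/
theorem exists_irredundant_subsystem [DecidableEq ι] (J : Finset ι) (a : ι → Fin n → ℝ)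
    (b : ι → ℝ) :
    ∃ I ⊆ J, {x | ∀ k ∈ I, b k ≤ linearForm (a k) x} = {x | ∀ k ∈ J, b k ≤ linearForm (a k) x} ∧
      ∀ k ∈ I, ∃ y, (∀ l ∈ I.erase k, b l ≤ linearForm (a l) y) ∧ linearForm (a k) y < b k := by
  obtain ⟨I, ⟨hIJ, hI⟩, hmin⟩ := exists_minimal_of_wellFoundedLT
    (fun I : Finset ι => I ⊆ J ∧
      {x | ∀ k ∈ I, b k ≤ linearForm (a k) x} = {x | ∀ k ∈ J, b k ≤ linearForm (a k) x})
    ⟨J, Finset.Subset.refl J, rfl⟩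
  refine ⟨I, hIJ, hI, fun k hk => ?_⟩
  by_contra! hcon
  refine Finset.notMem_erase k I (hmin (y := I.erase k) ⟨(Finset.erase_subset k I).trans hIJ, ?_⟩
    (Finset.erase_subset k I) hk)
  rw [← hI]
  ext x
  refine ⟨fun hx l hl => ?_, fun hx l hl => hx l (Finset.mem_of_mem_erase hl)⟩
  by_cases hlk : l = k
  · rw [hlk]; exact hcon x hx
  · exact hx l (Finset.mem_erase.2 ⟨hlk, hl⟩)

end Facets

/-! ### Integral descriptions of split polyhedra -/

/-- A split polyhedron given by rational inequalities has a point at which all the nontrivial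
inequalities are strict. -/
theorem exists_strict_of_maximal_isLatticeFreeConvex {p m : ℕ} (hp : 0 < p)
    {A : Fin m → Fin p → ℚ} {b : Fin m → ℚ}
    (hS : Maximal IsLatticeFreeConvex {x : Fin p → ℝ | ∀ k, (b k : ℝ) ≤ ∑ i, (A k i : ℝ) * x i}) :
    ∃ x₀ : Fin p → ℝ, (∀ k, (b k : ℝ) ≤ ∑ i, (A k i : ℝ) * x₀ i) ∧
      ∀ k, A k ≠ 0 → (b k : ℝ) < ∑ i, (A k i : ℝ) * x₀ i := by
  classical
  suffices h : ∀ J : Finset (Fin m), ∃ x₀ : Fin p → ℝ,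
      (∀ k, (b k : ℝ) ≤ ∑ i, (A k i : ℝ) * x₀ i) ∧
      ∀ k ∈ J, A k ≠ 0 → (b k : ℝ) < ∑ i, (A k i : ℝ) * x₀ i by
    obtain ⟨x₀, h1, h2⟩ := h Finset.univ
    exact ⟨x₀, h1, fun k => h2 k (Finset.mem_univ k)⟩
  intro J
  induction J using Finset.induction_on with
  | empty =>
    obtain ⟨x, hx⟩ := nonempty_of_maximal_isLatticeFreeConvex hp hS
    exact ⟨x, hx, by simp⟩
  | insert k J _ ih =>
    obtain ⟨x, hx, hxJ⟩ := ih
    by_cases hk : A k = 0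
    · refine ⟨x, hx, fun l hl hl0 => ?_⟩
      rcases Finset.mem_insert.1 hl with rfl | hl
      · exact absurd hk hl0
      · exact hxJ l hl hl0
    obtain ⟨c, π, π₀, hc, hπ, hπ₀, -⟩ := exists_isNormalized_multiple hk (b k)
    have hc' : (0 : ℝ) < c := by exact_mod_cast hc
    have hπ' : ∀ i, (π i : ℝ) = c * A k i := fun i => by exact_mod_cast hπ i
    have hπ₀' : (π₀ : ℝ) = c * b k := by exact_mod_cast hπ₀
    have hπ0 : π ≠ 0 := by
      rintro rfl
      refine hk (funext fun i => ?_)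
      have := hπ i
      simp only [Pi.zero_apply, Int.cast_zero, zero_eq_mul, hc.ne', false_or] at this
      exact this
    -- The `k`-th hyperplane is rational, so it does not contain the set. The midpoint of `x` and
    -- `y` is strict wherever one of them is.
    obtain ⟨y, hy, hyk⟩ := exists_linearForm_ne_of_maximal_isLatticeFreeConvex hp hS hπ0 π₀
    have hyk' : (b k : ℝ) < ∑ i, (A k i : ℝ) * y i := by
      refine lt_of_le_of_ne (hy k) fun h => hyk ?_
      rw [linearForm_apply, hπ₀', h, Finset.mul_sum]
      exact Finset.sum_congr rfl fun i _ => by rw [hπ', mul_assoc]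
    have hmid : ∀ l, ∑ i, (A l i : ℝ) * (((1 / 2 : ℝ) • x + (1 / 2 : ℝ) • y) i) =
        (∑ i, (A l i : ℝ) * x i + ∑ i, (A l i : ℝ) * y i) / 2 := fun l => by
      rw [← Finset.sum_add_distrib, Finset.sum_div]
      refine Finset.sum_congr rfl fun i _ => ?_
      simp only [Pi.add_apply, Pi.smul_apply, smul_eq_mul]
      ring
    refine ⟨(1 / 2 : ℝ) • x + (1 / 2 : ℝ) • y, fun l => ?_, fun l hl hl0 => ?_⟩
    · rw [hmid]
      have := hx l
      have := hy l
      linarith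
    · rw [hmid]
      have h1 := hx l
      have h2 : (b l : ℝ) ≤ ∑ i, (A l i : ℝ) * y i := hy l
      rcases Finset.mem_insert.1 hl with rfl | hl
      · linarith
      · have := hxJ l hl hl0
        linarith

theorem sub_le_of_width_le {n : ℕ} {L : Set (Fin n → ℝ)} {π : Fin n → ℤ} {w : ℝ}
    (h : width L π ≤ w) {x y : Fin n → ℝ} (hx : x ∈ L) (hy : y ∈ L) :
    ∑ i, (π i : ℝ) * x i - ∑ i, (π i : ℝ) * y i ≤ w := by
  have h1 : ((∑ i, (π i : ℝ) * x i : ℝ) : EReal) ≤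
      ⨆ x ∈ L, ((∑ i, (π i : ℝ) * x i : ℝ) : EReal) :=
    le_iSup₂ (f := fun x (_ : x ∈ L) => ((∑ i, (π i : ℝ) * x i : ℝ) : EReal)) x hx
  have h2 : (⨅ x ∈ L, ((∑ i, (π i : ℝ) * x i : ℝ) : EReal)) ≤
      ((∑ i, (π i : ℝ) * y i : ℝ) : EReal) :=
    iInf₂_le (f := fun x (_ : x ∈ L) => ((∑ i, (π i : ℝ) * x i : ℝ) : EReal)) y hy
  have h3 := (EReal.sub_le_sub h1 h2).trans h
  exact_mod_cast h3

/-- A mixed integer split polyhedron of max-facet-width at most `w` is defined by finitely many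
integral inequalities whose slack on the polyhedron is at most `w`, and its relative interior is
obtained by making all of them strict. -/
theorem exists_integral_description {p q : ℕ} (hp : 0 < p) {w : ℝ} {L : Set (Fin (p + q) → ℝ)}
    (hL : L ∈ splitPolyhedraOfWidth p q w) :
    ∃ (m : ℕ) (J : Finset (Fin m)) (π : Fin m → Fin (p + q) → ℤ) (π₀ : Fin m → ℤ),
      L = {x | ∀ k ∈ J, (π₀ k : ℝ) ≤ linearForm (fun i => (π k i : ℝ)) x} ∧
      intrinsicInterior ℝ L = {x | ∀ k ∈ J, (π₀ k : ℝ) < linearForm (fun i => (π k i : ℝ)) x} ∧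
      ∀ k ∈ J, ∀ x ∈ L, linearForm (fun i => (π k i : ℝ)) x - π₀ k ≤ w := by
  classical
  obtain ⟨⟨S, ⟨⟨m, A, b, rfl⟩, hS⟩, hLS⟩, hw⟩ := hL
  obtain ⟨x₀, hx₀, hx₀'⟩ := exists_strict_of_maximal_isLatticeFreeConvex hp hS
  let A' : Fin m → Fin (p + q) → ℚ := fun k => Fin.append (A k) 0
  let B : Fin m → Fin (p + q) → ℝ := fun k i => (A' k i : ℝ)
  have hB : ∀ k (x : Fin (p + q) → ℝ),
      linearForm (B k) x = ∑ i, (A k i : ℝ) * x (Fin.castAdd q i) := fun k x => by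
    rw [linearForm_apply, Fin.sum_univ_add]
    simp [B, A']
  have hLB : L = {x | ∀ k ∈ Finset.univ, (b k : ℝ) ≤ linearForm (B k) x} := by
    rw [hLS]
    ext x
    simp [hB]
  obtain ⟨J, -, hJ, hirr⟩ := exists_irredundant_subsystem Finset.univ B fun k => (b k : ℝ)
  rw [← hJ] at hLB
  let z₀ : Fin (p + q) → ℝ := Fin.append x₀ 0
  have hz₀ : ∀ k, linearForm (B k) z₀ = ∑ i, (A k i : ℝ) * x₀ i := fun k => by simp [hB, z₀]
  -- A zero row satisfied at `x₀` holds everywhere, which irredundancy excludes.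
  have hA0 : ∀ k ∈ J, A k ≠ 0 := fun k hk h0 => by
    obtain ⟨y, -, hy⟩ := hirr k hk
    have h1 := hx₀ k
    rw [hB] at hy
    simp only [h0, Pi.zero_apply, Rat.cast_zero, zero_mul, Finset.sum_const_zero] at h1 hy
    linarith
  have hB0 : ∀ k ∈ J, A' k ≠ 0 := fun k hk h0 => hA0 k hk (funext fun i => by
    have := congrFun h0 (Fin.castAdd q i)
    simpa [A'] using this)
  have hstrict : ∀ k ∈ J, (b k : ℝ) < linearForm (B k) z₀ := fun k hk => by
    rw [hz₀]
    exact hx₀' k (hA0 k hk)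
  have hnorm : ∀ k, ∃ (c : ℚ) (π : Fin (p + q) → ℤ) (π₀ : ℤ), k ∈ J → 0 < c ∧
      (∀ i, (π i : ℚ) = c * A' k i) ∧ (π₀ : ℚ) = c * b k ∧ IsNormalized π π₀ := fun k => by
    by_cases hk : k ∈ J
    · obtain ⟨c, π, π₀, h⟩ := exists_isNormalized_multiple (hB0 k hk) (b k)
      exact ⟨c, π, π₀, fun _ => h⟩
    · exact ⟨0, 0, 0, fun h => absurd h hk⟩
  choose c π π₀ hcπ using hnorm
  have hc : ∀ k ∈ J, (0 : ℝ) < c k := fun k hk => by exact_mod_cast (hcπ k hk).1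
  have hπ₀ : ∀ k ∈ J, (π₀ k : ℝ) = c k * b k := fun k hk => by exact_mod_cast (hcπ k hk).2.2.1
  have hπ : ∀ k ∈ J, ∀ x, linearForm (fun i => (π k i : ℝ)) x = c k * linearForm (B k) x :=
    fun k hk x => by
      rw [← linearForm_smul]
      congr 2
      funext i
      have := (hcπ k hk).2.1 i
      simp only [Pi.smul_apply, smul_eq_mul, B]
      exact_mod_cast this
  have hle : ∀ k ∈ J, ∀ x, (π₀ k : ℝ) ≤ linearForm (fun i => (π k i : ℝ)) x ↔
      (b k : ℝ) ≤ linearForm (B k) x := fun k hk x => by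
    rw [hπ k hk, hπ₀ k hk, mul_le_mul_iff_of_pos_left (hc k hk)]
  have hlt : ∀ k ∈ J, ∀ x, (π₀ k : ℝ) < linearForm (fun i => (π k i : ℝ)) x ↔
      (b k : ℝ) < linearForm (B k) x := fun k hk x => by
    rw [hπ k hk, hπ₀ k hk, mul_lt_mul_iff_of_pos_left (hc k hk)]
  have heq : ∀ k ∈ J, ∀ x, linearForm (fun i => (π k i : ℝ)) x = (π₀ k : ℝ) ↔
      linearForm (B k) x = (b k : ℝ) := fun k hk x => by
    rw [hπ k hk, hπ₀ k hk, mul_right_inj' (hc k hk).ne']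
  refine ⟨m, J, π, π₀, ?_, ?_, fun k hk x hx => ?_⟩
  · rw [hLB]
    exact Set.ext fun x => forall₂_congr fun k hk => (hle k hk x).symm
  · rw [hLB, intrinsicInterior_eq_of_strict hstrict]
    exact Set.ext fun x => forall₂_congr fun k hk => (hlt k hk x).symm
  -- The slack at `x` is the difference of the values of the form at `x` and at a point `z` of the
  -- facet, hence at most the facet width.
  · obtain ⟨y, hy, hyk⟩ := hirr k hk
    obtain ⟨z, hzk, hz⟩ := exists_mem_face_of_irredundant hstrict hk hy hyk
    have hzL : z ∈ L := by
      rw [hLB]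
      intro l hl
      by_cases hlk : l = k
      · rw [hlk, hzk]
      · exact (hz l (Finset.mem_erase.2 ⟨hlk, hl⟩)).le
    have hface : {x ∈ L | ∑ i, (π k i : ℝ) * x i = (π₀ k : ℝ)} =
        {x ∈ {x | ∀ k ∈ J, (b k : ℝ) ≤ linearForm (B k) x} | linearForm (B k) x = b k} := by
      rw [← hLB]
      exact Set.ext fun x => and_congr_right fun _ => by rw [← heq k hk, linearForm_apply]
    have hfacet : IsFacetDefining L (π k) (π₀ k) := by
      refine ⟨fun x hx => ?_, ⟨z, hzL, ?_⟩, ?_⟩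
      · rw [← linearForm_apply, hle k hk]
        rw [hLB] at hx
        exact hx k hk
      · rw [← linearForm_apply, heq k hk]
        exact hzk
      · rw [hface, finrank_vectorSpan_face ?_ hzk hz, hLB,
          vectorSpan_eq_top_of_strict hstrict]
        · simp
        · intro h0
          exact hB0 k hk (funext fun i => by
            have : (A' k i : ℝ) = 0 := congrFun h0 i
            exact_mod_cast this)
    have hwidth : width L (π k) ≤ w := by
      refine le_trans ?_ hw
      exact le_iSup_of_le (π k) (le_iSup_of_le (π₀ k)
        (le_iSup_of_le ⟨hfacet, (hcπ k hk).2.2.2⟩ le_rfl))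
    have := sub_le_of_width_le hwidth hx hzL
    rw [← linearForm_apply, ← linearForm_apply, (heq k hk z).2 hzk] at this
    exact this

/-- Otherwise one could choose inductively a sequence no term of which is dominated by an earlier
one. -/
theorem exists_finite_dominating {ι α : Type*} {r : α → α → Prop} (hr : WellQuasiOrdered r)
    (f : ι → α) : ∃ F : Finset ι, ∀ i, ∃ j ∈ F, r (f j) (f i) := by
  by_contra! h
  obtain ⟨e, -, he⟩ := exists_seq_of_forall_finset_exists (fun _ : ι => True)
    (fun j i => ¬r (f j) (f i)) fun F _ => (h F).imp fun i hi => ⟨trivial, hi⟩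
  obtain ⟨m, n, hmn, hle⟩ := hr (f ∘ e)
  exact he m n hmn hle

/-! ### Cones generated by exit points -/

/-- The generators `g b`, `b ∈ O`, together with the points `g a + t • g b`, `t ∈ s a b`, on the
segments from the generators outside `O` to those in `O`. -/
def cutGenerators {A M : Type*} [AddCommGroup M] [Module ℝ M] (g : A → M) (O : Set A)
    (s : A → A → Set ℝ) : Set M :=
  g '' O ∪ {x | ∃ a ∉ O, ∃ b ∈ O, ∃ t ∈ s a b, x = g a + t • g b}

section CutGenerators

variable {A M : Type*} [AddCommGroup M] [Module ℝ M] {g : A → M} {O : Set A} {s s' : A → A → Set ℝ}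

theorem finite_cutGenerators [Finite A] (hs : ∀ a b, (s a b).Finite) :
    (cutGenerators g O s).Finite := by
  refine (O.toFinite.image g).union ?_
  refine (Set.finite_iUnion fun p : A × A =>
    (hs p.1 p.2).image fun t => g p.1 + t • g p.2).subset ?_
  rintro _ ⟨a, -, b, -, t, ht, rfl⟩
  exact Set.mem_iUnion.2 ⟨(a, b), t, ht, rfl⟩

/-- Since `g a + t' • g b = (g a + t • g b) + (t' - t) • g b` and `g b` is a generator, earlier
exits give larger cones. -/
theorem hull_cutGenerators_le (h : ∀ a b, ∀ t' ∈ s' a b, ∃ t ∈ s a b, t ≤ t') :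
    PointedCone.hull ℝ (cutGenerators g O s') ≤ PointedCone.hull ℝ (cutGenerators g O s) := by
  refine Submodule.span_le.2 ?_
  rintro _ (⟨b, hb, rfl⟩ | ⟨a, ha, b, hb, t', ht', rfl⟩)
  · exact Submodule.subset_span (Or.inl ⟨b, hb, rfl⟩)
  · obtain ⟨t, ht, hle⟩ := h a b t' ht'
    have h1 : g a + t • g b ∈ PointedCone.hull ℝ (cutGenerators g O s) :=
      Submodule.subset_span (Or.inr ⟨a, ha, b, hb, t, ht, rfl⟩)
    have h2 : g b ∈ PointedCone.hull ℝ (cutGenerators g O s) :=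
      Submodule.subset_span (Or.inl ⟨b, hb, rfl⟩)
    have h3 := add_mem h1 (smul_mem_hull (sub_nonneg.2 hle) h2)
    rw [add_assoc, ← add_smul, add_sub_cancel] at h3
    exact h3

theorem convex_slice (K : PointedCone ℝ (ℝ × M)) : Convex ℝ {x | ((1 : ℝ), x) ∈ K} := by
  intro x hx y hy a b ha hb hab
  have := K.add_mem (PointedCone.smul_mem K ha hx) (PointedCone.smul_mem K hb hy)
  simpa [hab] using this

end CutGenerators

/-! ### The relaxation as a slice of a cone -/

section Relaxation

variable {n : ℕ} {A κ : Type*} {g : A → ℝ × (Fin n → ℝ)} {J : Finset κ}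
  {f : κ → Module.Dual ℝ (ℝ × (Fin n → ℝ))} {w : ℝ} {L P : Set (Fin n → ℝ)}

/-- If all the facets of `L` have finite width, then the recession cone of `P` consists of recession
directions of the relaxation. -/
theorem add_mem_relaxation
    (hri : intrinsicInterior ℝ L = {x | ∀ k ∈ J, 0 < f k (1, x)})
    (hw : ∀ k ∈ J, ∀ x ∈ L, f k (1, x) ≤ w) {c : Fin n → ℝ}
    (hc : ∀ x ∈ P, ∀ t : ℝ, 0 ≤ t → x + t • c ∈ P) {x : Fin n → ℝ} (hx : x ∈ relaxation L P) :
    x + c ∈ relaxation L P := by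
  suffices h : relaxation L P ⊆ (fun y => y + c) ⁻¹' relaxation L P from h hx
  refine convexHull_min ?_ ((convex_convexHull ℝ _).translate_preimage_left c)
  rintro z ⟨hz, hzL⟩
  -- If the ray is outside `ri L` at some `t ≥ 1`, then `z + c` lies between two points that are
  -- kept. Otherwise the slacks stay bounded by `w` along the ray, hence are nonincreasing, and
  -- their positivity at `t = 1` would already put `z` in `ri L`.
  by_cases h : ∃ t : ℝ, 1 ≤ t ∧ z + t • c ∉ intrinsicInterior ℝ L
  · obtain ⟨t, ht, hzt⟩ := h
    have h1 : z ∈ relaxation L P := subset_convexHull ℝ _ ⟨hz, hzL⟩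
    have h2 : z + t • c ∈ relaxation L P :=
      subset_convexHull ℝ _ ⟨hc z hz t (by linarith), hzt⟩
    have h3 := convex_convexHull ℝ _ h1 h2 (a := 1 - t⁻¹) (b := t⁻¹)
      (sub_nonneg.2 (inv_le_one_of_one_le₀ ht)) (by positivity) (by ring)
    have h4 : (1 - t⁻¹) • z + t⁻¹ • (z + t • c) = z + c := by
      rw [smul_add, smul_smul, inv_mul_cancel₀ (by positivity), one_smul, ← add_assoc, ← add_smul,
        sub_add_cancel, one_smul]
    rwa [h4] at h3
  · push Not at h
    refine absurd ?_ hzL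
    rw [hri]
    intro k hk
    have hlin : ∀ t : ℝ, f k (1, z + t • c) = f k (1, z) + t * f k (0, c) := fun t => by
      have : ((1 : ℝ), z + t • c) = (1, z) + t • ((0 : ℝ), c) := by simp
      rw [this, map_add, map_smul, smul_eq_mul]
    have hbd : ∀ t : ℝ, 1 ≤ t → 0 < f k (1, z) + t * f k (0, c) ∧
        f k (1, z) + t * f k (0, c) ≤ w := fun t ht => by
      have h1 := h t ht
      rw [← hlin]
      exact ⟨(hri ▸ h1 : z + t • c ∈ {x | ∀ k ∈ J, 0 < f k (1, x)}) k hk,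
        hw k hk _ (intrinsicInterior_subset h1)⟩
    set u := f k (1, z)
    set d := f k (0, c)
    have hd : d ≤ 0 := by
      by_contra hd
      push Not at hd
      -- At this parameter the slack is `u + d + |w - u| + 1 > w`.
      have := (hbd (1 + (|w - u| + 1) / d) (by
        have : 0 < (|w - u| + 1) / d := by positivity
        linarith)).2
      rw [add_mul, div_mul_cancel₀ _ hd.ne'] at this
      linarith [le_abs_self (w - u)]
    have := (hbd 1 le_rfl).1
    linarith

/-- The relaxation is the slice at height one of the cone spanned by the homogenized generators
outside the relative interior and the points at which the segments and rays from the generators in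
the relative interior leave it. -/
theorem relaxation_eq_slice {O : Set A} {s : A → A → Set ℝ} (hg : ∀ a, 0 ≤ (g a).1)
    (hri : intrinsicInterior ℝ L = {x | ∀ k ∈ J, 0 < f k (1, x)})
    (hw : ∀ k ∈ J, ∀ x ∈ L, f k (1, x) ≤ w)
    (hin : ∀ a ∉ O, 0 < (g a).1 ∧ ∀ k ∈ J, 0 < f k (g a))
    (hout : ∀ a ∈ O, (g a).1 = 0 ∨ ∃ k ∈ J, f k (g a) ≤ 0)
    (hs : ∀ a ∉ O, ∀ b ∈ O, ∀ t ∈ s a b, 0 ≤ t ∧ ∃ k ∈ J, f k (g a + t • g b) ≤ 0)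
    (hs' : ∀ a ∉ O, ∀ b ∈ O, ∀ k ∈ J, f k (g b) < 0 →
      ∃ t ∈ s a b, 0 ≤ f k (g a + t • g b)) :
    relaxation L {x | ((1 : ℝ), x) ∈ PointedCone.hull ℝ (Set.range g)} =
      {x | ((1 : ℝ), x) ∈ PointedCone.hull ℝ (cutGenerators g O s)} := by
  apply Set.Subset.antisymm
  · refine convexHull_min ?_ (convex_slice _)
    rintro x ⟨hx, hxL⟩
    rw [hri] at hxL
    obtain ⟨k, hk, hkx⟩ : ∃ k ∈ J, f k (1, x) ≤ 0 := by
      by_contra! h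
      exact hxL h
    have hO : ∀ b ∈ O, g b ∈ PointedCone.hull ℝ (cutGenerators g O s) := fun b hb =>
      Submodule.subset_span (Or.inl ⟨b, hb, rfl⟩)
    have hmem : ∀ a, f k (g a) ≤ 0 → a ∈ O := fun a ha => by
      by_contra h
      exact ((hin a h).2 k hk).not_ge ha
    refine mem_of_mem_hull_of_nonpos (K := PointedCone.hull ℝ (cutGenerators g O s)) (f := f k)
      ?_ ?_ hx hkx
    · rintro _ ⟨a, rfl⟩ ha
      exact hO a (hmem a ha)
    · rintro _ ⟨a, rfl⟩ _ ⟨b, rfl⟩ ha hb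
      have hbK := hO b (hmem b hb)
      by_cases haO : a ∈ O
      · exact add_mem (smul_mem_hull (neg_nonneg.2 hb) (hO a haO)) (smul_mem_hull ha.le hbK)
      · rcases hb.eq_or_lt with hb0 | hb0
        · rw [hb0, neg_zero, zero_smul, zero_add]
          exact smul_mem_hull ha.le hbK
        -- With `e = g a + t • g b`, the required vector equals `(-f k (g b)) • e + f k e • g b`.
        -- Both coefficients are nonnegative because `e` does not lie beyond the `k`-th hyperplane.
        · obtain ⟨t, ht, hft⟩ := hs' a haO b (hmem b hb) k hk hb0
          have h1 : g a + t • g b ∈ PointedCone.hull ℝ (cutGenerators g O s) :=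
            Submodule.subset_span (Or.inr ⟨a, haO, b, hmem b hb, t, ht, rfl⟩)
          have h2 := add_mem (smul_mem_hull (neg_nonneg.2 hb) h1) (smul_mem_hull hft hbK)
          convert h2 using 1
          simp only [map_add, map_smul, smul_eq_mul]
          module
  · intro x hx
    set K := PointedCone.hull ℝ (Set.range g) with hK
    have hgK : ∀ a, g a ∈ K := fun a => Submodule.subset_span ⟨a, rfl⟩
    have hKP : ∀ y ∈ K, 0 < y.1 → y.1⁻¹ • y.2 ∈ {x | ((1 : ℝ), x) ∈ K} := fun y hy h => by
      have := PointedCone.smul_mem K (inv_nonneg.2 h.le) hy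
      have e : y.1⁻¹ • y = (1, y.1⁻¹ • y.2) := Prod.ext (inv_mul_cancel₀ h.ne') rfl
      rwa [e] at this
    have hKR : ∀ y ∈ K, 0 < y.1 → (∃ k ∈ J, f k y ≤ 0) →
        y.1⁻¹ • y.2 ∈ relaxation L {x | ((1 : ℝ), x) ∈ K} := by
      rintro y hy h ⟨k, hk, hky⟩
      refine subset_convexHull ℝ _ ⟨hKP y hy h, ?_⟩
      rw [hri]
      intro hcon
      have h1 : 0 < f k (1, y.1⁻¹ • y.2) := hcon k hk
      have e : (1, y.1⁻¹ • y.2) = y.1⁻¹ • y := Prod.ext (inv_mul_cancel₀ h.ne').symm rfl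
      rw [e, map_smul, smul_eq_mul] at h1
      exact h1.not_ge (mul_nonpos_of_nonneg_of_nonpos (inv_nonneg.2 h.le) hky)
    -- `C` consists of the directions `c` with `(0, c) ∈ K`, all of which are recession directions
    -- of `P`.
    refine mem_of_one_mem_hull (C := PointedCone.comap (LinearMap.inr ℝ ℝ (Fin n → ℝ)) K)
      (convex_convexHull ℝ _) (fun y hy c hc => ?_) ?_ hx
    · refine add_mem_relaxation hri hw (fun z hz t ht => ?_) hy
      have hc' : ((0 : ℝ), c) ∈ K := hc
      have h1 := K.add_mem hz (PointedCone.smul_mem K ht hc')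
      simpa using h1
    · rintro _ (⟨b, hb, rfl⟩ | ⟨a, ha, b, hb, t, ht, rfl⟩)
      · rcases (hg b).eq_or_lt with h0 | h0
        · refine Or.inl ⟨h0.symm, ?_⟩
          change ((0 : ℝ), (g b).2) ∈ K
          have e : g b = (0, (g b).2) := Prod.ext h0.symm rfl
          exact e ▸ hgK b
        · exact Or.inr ⟨h0, hKR _ (hgK b) h0 ((hout b hb).resolve_left h0.ne')⟩
      · obtain ⟨ht0, hk⟩ := hs a ha b hb t ht
        have hpos : 0 < (g a + t • g b).1 := by
          have h1 := (hin a ha).1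
          have h2 := mul_nonneg ht0 (hg b)
          simp only [Prod.fst_add, Prod.smul_fst, smul_eq_mul]
          linarith
        exact Or.inr ⟨hpos, hKR _ (K.add_mem (hgK a) (PointedCone.smul_mem K ht0 (hgK b))) hpos hk⟩

end Relaxation

/-! ### Homogenization of `P` and exit parameters -/

/-- The homogenized generators of `conv {vⁱ} + cone {rʲ}`. -/
def homogenization {n : ℕ} {V E : Type*} (v : V → Fin n → ℚ) (r : E → Fin n → ℤ) :
    V ⊕ E → ℝ × (Fin n → ℝ) :=
  Sum.elim (fun i => (1, fun k => (v i k : ℝ))) (fun j => (0, fun k => (r j k : ℝ)))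

theorem innerPolyhedron_eq_slice {n : ℕ} {V E : Type*} (v : V → Fin n → ℚ) (r : E → Fin n → ℤ) :
    innerPolyhedron v r =
      {x | ((1 : ℝ), x) ∈ PointedCone.hull ℝ (Set.range (homogenization v r))} := by
  apply Set.Subset.antisymm
  · rintro _ ⟨x, hx, c, hc, rfl⟩
    have h1 : ((1 : ℝ), x) ∈ PointedCone.hull ℝ (Set.range (homogenization v r)) := by
      refine convexHull_min (t := {x | ((1 : ℝ), x) ∈ PointedCone.hull ℝ
        (Set.range (homogenization v r))}) ?_ (convex_slice _) hx
      rintro _ ⟨i, rfl⟩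
      exact Submodule.subset_span ⟨Sum.inl i, rfl⟩
    have h2 : ((0 : ℝ), c) ∈ PointedCone.hull ℝ (Set.range (homogenization v r)) := by
      refine hull_le_of_subset (p := fun c => ((0 : ℝ), c) ∈ PointedCone.hull ℝ
        (Set.range (homogenization v r))) (zero_mem _) ?_ ?_ ?_ hc
      · intro x y hx hy
        simpa using add_mem hx hy
      · intro t x ht hx
        simpa using smul_mem_hull ht hx
      · rintro _ ⟨j, rfl⟩
        exact Submodule.subset_span ⟨Sum.inr j, rfl⟩
    simpa using add_mem h1 h2
  · intro x hx
    refine mem_of_one_mem_hull (C := PointedCone.hull ℝ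
      (Set.range fun (j : E) (k : Fin n) => (r j k : ℝ)))
      ((convex_convexHull ℝ _).add (PointedCone.convex _)) ?_ ?_ hx
    · rintro _ ⟨y, hy, c, hc, rfl⟩ d hd
      exact ⟨y, hy, c + d, add_mem hc hd, (add_assoc y c d).symm⟩
    · rintro _ ⟨i | j, rfl⟩
      · refine Or.inr ⟨one_pos, ?_⟩
        simp only [homogenization, Sum.elim_inl, inv_one, one_smul]
        exact ⟨_, subset_convexHull ℝ _ ⟨i, rfl⟩, 0, zero_mem _, add_zero _⟩
      · exact Or.inl ⟨rfl, Submodule.subset_span ⟨j, rfl⟩⟩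

/-- The set of exit parameters encoded by an optional numerator and a denominator. -/
def exitSet {M : ℕ} (e : Option (Fin M)) (N : ℕ) : Set ℝ :=
  {t | ∃ m ∈ e, t = (m : ℝ) / (N + 1)}

theorem finite_exitSet {M : ℕ} (e : Option (Fin M)) (N : ℕ) : (exitSet e N).Finite := by
  refine (Set.finite_range fun m : Fin M => (m : ℝ) / (N + 1)).subset ?_
  rintro _ ⟨m, -, rfl⟩
  exact ⟨m, rfl⟩

theorem exists_exitSet_le {M : ℕ} {e : Option (Fin M)} {N N' : ℕ} (h : N ≤ N') {t : ℝ}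
    (ht : t ∈ exitSet e N) : ∃ t' ∈ exitSet e N', t' ≤ t := by
  obtain ⟨m, hm, rfl⟩ := ht
  refine ⟨_, ⟨m, hm, rfl⟩, ?_⟩
  have : (N : ℝ) ≤ N' := by exact_mod_cast h
  gcongr

/-- Here `x` and `y` are the slacks of an inner and an outer generator. The first exit is the
minimum of `x k / -y k` over `y k < 0`; scaling by `D` makes it a quotient of integers whose
numerator is at most `D * w`. -/
theorem exists_exitSet {κ : Type*} {J : Finset κ} {x y : κ → ℝ} {D : ℕ} (hD : 0 < D) {w : ℝ}
    (hx : ∀ k ∈ J, 0 < x k ∧ x k ≤ w) (hxZ : ∀ k, ∃ z : ℤ, (D : ℝ) * x k = z)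
    (hyZ : ∀ k, ∃ z : ℤ, (D : ℝ) * y k = z) :
    ∃ (e : Option (Fin (⌊D * w⌋₊ + 1))) (N : ℕ),
      (∀ t ∈ exitSet e N, 0 ≤ t ∧ ∃ k ∈ J, x k + t * y k ≤ 0) ∧
      ∀ k ∈ J, y k < 0 → ∃ t ∈ exitSet e N, 0 ≤ x k + t * y k := by
  classical
  have hD' : (0 : ℝ) < D := by exact_mod_cast hD
  by_cases hne : (J.filter fun k => y k < 0).Nonempty
  · obtain ⟨k, hk, hmin⟩ := Finset.exists_min_image _ (fun k => x k / -y k) hne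
    obtain ⟨hkJ, hyk⟩ := Finset.mem_filter.1 hk
    obtain ⟨a, ha⟩ := hxZ k
    obtain ⟨b, hb⟩ := hyZ k
    obtain ⟨hx0, hxw⟩ := hx k hkJ
    have ha0 : 0 ≤ a := by
      have : (0 : ℝ) ≤ a := ha ▸ by positivity
      exact_mod_cast this
    have hb0 : b < 0 := by
      have : (b : ℝ) < 0 := hb ▸ mul_neg_of_pos_of_neg hD' hyk
      exact_mod_cast this
    lift a to ℕ using ha0
    -- The shift by one lets `N` range over all of `ℕ` with a positive denominator.
    obtain ⟨N, rfl⟩ : ∃ N : ℕ, b = -(N + 1) := ⟨(-b - 1).toNat, by omega⟩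
    have haM : a < ⌊D * w⌋₊ + 1 := by
      refine Nat.lt_succ_of_le (Nat.le_floor ?_)
      have : (a : ℝ) = D * x k := by rw [ha]; simp
      rw [this]
      gcongr
    have ht : (a : ℝ) / (N + 1) = x k / -y k := by
      have h1 : (a : ℝ) = D * x k := by rw [ha]; simp
      have h2 : (N + 1 : ℝ) = D * -y k := by
        rw [mul_neg, hb]; push_cast; ring
      rw [h1, h2, mul_div_mul_left _ _ hD'.ne']
    have hmem : x k / -y k ∈ exitSet (some (⟨a, haM⟩ : Fin (⌊D * w⌋₊ + 1))) N :=
      ⟨_, rfl, ht.symm⟩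
    refine ⟨some ⟨a, haM⟩, N, ?_, fun l hl hyl => ⟨_, hmem, ?_⟩⟩
    · rintro _ ⟨m, hm, rfl⟩
      obtain rfl : (⟨a, haM⟩ : Fin _) = m := Option.some_inj.1 hm
      refine ⟨by positivity, k, hkJ, ?_⟩
      dsimp only
      rw [ht, div_neg, neg_mul, div_mul_cancel₀ _ hyk.ne, add_neg_cancel]
    · have h1 := hmin l (Finset.mem_filter.2 ⟨hl, hyl⟩)
      rw [le_div_iff₀ (neg_pos.2 hyl)] at h1
      linarith
  -- No slack decreases, so the ray never leaves and there is no exit point.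
  · refine ⟨none, 0, ?_, fun k hk hyk => absurd ⟨k, Finset.mem_filter.2 ⟨hk, hyk⟩⟩ hne⟩
    rintro _ ⟨m, hm, -⟩
    cases hm

theorem exists_common_denominator {n : ℕ} {V : Type*} [Finite V] (v : V → Fin n → ℚ) :
    ∃ D : ℕ, 0 < D ∧ ∀ i k, ∃ z : ℤ, (D : ℝ) * (v i k : ℝ) = z := by
  classical
  have := Fintype.ofFinite V
  refine ⟨∏ p : V × Fin n, (v p.1 p.2).den, Finset.prod_pos fun p _ => (v p.1 p.2).pos,
    fun i k => ?_⟩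
  obtain ⟨c, hc⟩ := Finset.dvd_prod_of_mem (fun p : V × Fin n => (v p.1 p.2).den)
    (Finset.mem_univ (i, k))
  refine ⟨c * (v i k).num, ?_⟩
  rw [hc]
  have h := Rat.mul_den_eq_num (v i k)
  have h' : (v i k : ℝ) * (v i k).den = (v i k).num := by exact_mod_cast h
  push_cast
  rw [← h']
  ring

/-! ### Finite domination and the closure -/

section Closure

variable {p q : ℕ} {V E : Type*} [Finite V] (v : V → Fin (p + q) → ℚ) (r : E → Fin (p + q) → ℤ)

/-- For all the split polyhedra of bounded max-facet-width, the exit parameters have bounded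
numerators, with respect to a common denominator that depends on `P` only. -/
theorem exists_bound_relaxation_eq_slice (hp : 0 < p) (w : ℝ) :
    ∃ M : ℕ, ∀ L ∈ splitPolyhedraOfWidth p q w,
      ∃ (O : Set (V ⊕ E)) (e : V ⊕ E → V ⊕ E → Option (Fin M)) (N : V ⊕ E → V ⊕ E → ℕ),
        relaxation L (innerPolyhedron v r) = {x | ((1 : ℝ), x) ∈ PointedCone.hull ℝ
          (cutGenerators (homogenization v r) O fun a b => exitSet (e a b) (N a b))} := by
  classical
  obtain ⟨D, hD, hDv⟩ := exists_common_denominator v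
  refine ⟨⌊D * w⌋₊ + 1, fun L hL => ?_⟩
  obtain ⟨m, J, π, π₀, hLJ, hri, hw⟩ := exists_integral_description hp hL
  set g := homogenization v r with hg
  let f : Fin m → Module.Dual ℝ (ℝ × (Fin (p + q) → ℝ)) := fun k =>
    (linearForm fun i => (π k i : ℝ)).comp (LinearMap.snd ℝ ℝ _) -
      (π₀ k : ℝ) • LinearMap.fst ℝ ℝ _
  have hf : ∀ k t x, f k (t, x) = linearForm (fun i => (π k i : ℝ)) x - π₀ k * t := fun k t x => by
    simp [f]
  have hL' : L = {x | ∀ k ∈ J, 0 ≤ f k (1, x)} := by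
    simp only [hf, mul_one, sub_nonneg]
    exact hLJ
  have hri' : intrinsicInterior ℝ L = {x | ∀ k ∈ J, 0 < f k (1, x)} := by
    simp only [hf, mul_one, sub_pos]
    exact hri
  have hw' : ∀ k ∈ J, ∀ x ∈ L, f k (1, x) ≤ w := by
    simpa only [hf, mul_one] using hw
  have hint : ∀ k a, ∃ z : ℤ, (D : ℝ) * f k (g a) = z := by
    rintro k (i | j)
    · choose z hz using hDv i
      refine ⟨∑ l, π k l * z l - D * π₀ k, ?_⟩
      simp only [hg, homogenization, Sum.elim_inl, hf, linearForm_apply, mul_sub, Finset.mul_sum]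
      push_cast
      rw [mul_one]
      congr 1
      exact Finset.sum_congr rfl fun l _ => by rw [← hz]; ring
    · refine ⟨D * ∑ l, π k l * r j l, ?_⟩
      simp only [hg, homogenization, Sum.elim_inr, hf, linearForm_apply]
      push_cast
      ring
  -- Rays belong to `O` whatever their slacks, so a generator outside `O` is a vertex in `ri L`,
  -- where the bound `w` applies.
  let O : Set (V ⊕ E) := {a | (g a).1 = 0 ∨ ∃ k ∈ J, f k (g a) ≤ 0}
  have hin : ∀ a ∉ O, (g a).1 = 1 ∧ ∀ k ∈ J, 0 < f k (g a) := by
    intro a ha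
    simp only [O, Set.mem_ofPred_eq, not_or, not_exists, not_and, not_le] at ha
    refine ⟨?_, ha.2⟩
    rcases a with i | j
    · rfl
    · exact absurd rfl ha.1
  have hbound : ∀ a ∉ O, ∀ k ∈ J, 0 < f k (g a) ∧ f k (g a) ≤ w := fun a ha k hk => by
    obtain ⟨h1, h2⟩ := hin a ha
    have e : g a = (1, (g a).2) := Prod.ext h1 rfl
    refine ⟨h2 k hk, ?_⟩
    rw [e]
    refine hw' k hk _ ?_
    rw [hL']
    intro l hl
    rw [← e]
    exact (h2 l hl).le
  have hexit : ∀ a b, ∃ (e : Option (Fin (⌊D * w⌋₊ + 1))) (N : ℕ), a ∉ O →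
      (∀ t ∈ exitSet e N, 0 ≤ t ∧ ∃ k ∈ J, f k (g a) + t * f k (g b) ≤ 0) ∧
      ∀ k ∈ J, f k (g b) < 0 → ∃ t ∈ exitSet e N, 0 ≤ f k (g a) + t * f k (g b) := by
    intro a b
    by_cases ha : a ∈ O
    · exact ⟨none, 0, fun h => absurd ha h⟩
    · obtain ⟨e, N, h⟩ := exists_exitSet (x := fun k => f k (g a)) (y := fun k => f k (g b)) hD
        (hbound a ha) (fun k => hint k a) (fun k => hint k b)
      exact ⟨e, N, fun _ => h⟩
  choose e N heN using hexit
  have hadd : ∀ k a b (t : ℝ), f k (g a + t • g b) = f k (g a) + t * f k (g b) :=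
    fun k a b t => by rw [map_add, map_smul, smul_eq_mul]
  refine ⟨O, e, N, ?_⟩
  rw [innerPolyhedron_eq_slice, ← hg]
  refine relaxation_eq_slice (f := f) (J := J) ?_ hri' hw' ?_ (fun a ha => ha) ?_ ?_
  · rintro (i | j)
    · exact zero_le_one
    · exact le_rfl
  · exact fun a ha => ⟨(hin a ha).1 ▸ one_pos, (hin a ha).2⟩
  · intro a ha b _
    simpa only [hadd] using (heN a b ha).1
  · intro a ha b _
    simpa only [hadd] using (heN a b ha).2

theorem isPolyhedron_iInter_relaxation [Finite E] (hp : 0 < p) (w : ℝ)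
    {𝓛 : Set (Set (Fin (p + q) → ℝ))} (h𝓛 : 𝓛 ⊆ splitPolyhedraOfWidth p q w) :
    IsPolyhedron (⋂ L ∈ 𝓛, relaxation L (innerPolyhedron v r)) := by
  obtain ⟨M, hM⟩ := exists_bound_relaxation_eq_slice v r hp w
  choose O e N h using fun L : 𝓛 => hM L (h𝓛 L.2)
  -- The pair of `O` and the numerators takes finitely many values and is compared by equality; the
  -- denominators are compared componentwise, by Dickson's lemma.
  have hwqo : WellQuasiOrdered fun
      x y : (Set (V ⊕ E) × (V ⊕ E → V ⊕ E → Option (Fin M))) × (V ⊕ E → V ⊕ E → ℕ) =>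
        x.1 = y.1 ∧ x.2 ≤ y.2 :=
    (Finite.wellQuasiOrdered _).prod wellQuasiOrdered_le
  obtain ⟨F, hF⟩ := exists_finite_dominating hwqo fun L : 𝓛 => ((O L, e L), N L)
  convert isPolyhedron_iInter_slice_hull F (S := fun L =>
    cutGenerators (homogenization v r) (O L) fun a b => exitSet (e L a b) (N L a b))
    (fun L => finite_cutGenerators fun a b => finite_exitSet _ _) using 1
  simp only [← h]
  refine Set.Subset.antisymm ?_ ?_
  · exact fun x hx => Set.mem_iInter₂.2 fun L _ => Set.mem_iInter₂.1 hx L L.2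
  · refine fun x hx => Set.mem_iInter₂.2 fun L hL => ?_
    obtain ⟨L', hL', heq, hle⟩ := hF ⟨L, hL⟩
    have hx' := Set.mem_iInter₂.1 hx L' hL'
    obtain ⟨hO, he⟩ := Prod.mk.inj heq
    rw [h] at hx'
    have := h ⟨L, hL⟩
    dsimp only at this
    rw [this, ← hO, ← he]
    refine hull_cutGenerators_le (fun a b t ht => ?_) hx'
    exact exists_exitSet_le (hle a b) ht

end Closure

end SplitClosure

theorem theorem3 (p q : ℕ) (hp : 0 < p) {V E : Type*} [Finite V] [Finite E]
    (v : V → Fin (p + q) → ℚ) (r : E → Fin (p + q) → ℤ) (w : ℝ) (hw : 0 < w) :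
    (∀ 𝓛 : Set (Set (Fin (p + q) → ℝ)),
      𝓛 ⊆ SplitClosure.splitPolyhedraOfWidth p q w →
      SplitClosure.IsPolyhedron
        (⋂ L ∈ 𝓛, SplitClosure.relaxation L (SplitClosure.innerPolyhedron v r))) ∧
    SplitClosure.IsPolyhedron
      (SplitClosure.splitClosure p q w (SplitClosure.innerPolyhedron v r)) :=
  ⟨fun _ h𝓛 => SplitClosure.isPolyhedron_iInter_relaxation v r hp w h𝓛,
    SplitClosure.isPolyhedron_iInter_relaxation v r hp w subset_rfl⟩
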